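/- Consider $n$ players with distinct identifiers, connected in a clique, in the synchronous sleeping model: in every round each player is either awake or asleep; only awake players compute, send and receive messages, and a message sent to a sleeping player is lost. An omniscient adversary crashes at most $f$ players, where $0\le f<n$; of the messages that a player sends in the round in which it crashes, an arbitrary subset is delivered, and the player does nothing in later rounds. Every player starts with a one-bit input. There is a deterministic algorithm (given $n$, $f$, and for each player its identifier and its input bit) that solves binary consensus in $f+1$ rounds. That is, in every execution: every player that does not crash in rounds $1,\dots,f+1$ has decided and terminated by the end of round $f+1$; no two players (including faulty ones) decide on different values; and every decision value is the input of some player. Moreover, in every execution the algorithm sends $\mathcal{O}(n^2)$ messages in total, every message consists of $\mathcal{O}(1)$ bits, and every player is awake in at most $\mathcal{O}(\max\{1,\lceil f/\sqrt{n}\,\rceil\})$ rounds (energy complexity), where the implied constants are absolute, i.e., independent of $n$, $f$, the inputs and the execution. For $f\ge 1$ the energy bound is $\mathcal{O}(\lceil f/\sqrt{n}\,\rceil)$. -/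

import Mathlib

/-- A message is a string of bits; its size is its length. -/
abbrev Message : Type := List Bool

/-- A deterministic algorithm for `n` players with identifiers in `Fin n` and one-bit inputs, in the
synchronous sleeping model. All players share a round clock; rounds are numbered `1, 2, 3, …`.

* `init p x` is the state of player `p` with input `x` before round `1`;
* `wake r s` tells whether a player in state `s` is awake in round `r`;
* `send r s q` is the message, if any, that a player awake in round `r` with state `s` sends to `q`;
* `step r s m` is the new state of a player that is awake in round `r` with state `s` and receives
  in this round the messages `m` (`m q` is the message from `q`, if there is one);
* `output s` is the value on which a player in state `s` has decided, if it has. -/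
structure Protocol (n : ℕ) where
  State : Type
  init : Fin n → Bool → State
  wake : ℕ → State → Bool
  send : ℕ → State → Fin n → Option Message
  step : ℕ → State → (Fin n → Option Message) → State
  output : State → Option Bool

/-- The choices of the adversary.

* `crash p = some r` if player `p` crashes in round `r`, and `none` if `p` is non-faulty;
* `passes p q` tells whether a message which `p` sends to `q` in the round in which `p` crashes
  is delivered;
* `completes p` tells whether `p` still performs its local computation at the end of the round in
  which it crashes. -/
structure CrashPattern (n : ℕ) where
  crash : Fin n → Option ℕ
  passes : Fin n → Fin n → Bool
  completes : Fin n → Bool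

namespace CrashPattern

variable {n : ℕ}

/-- `p` is alive in round `r`: it does not crash in the rounds before `r`. -/
def Alive (c : CrashPattern n) (p : Fin n) (r : ℕ) : Prop :=
  ∀ k ∈ c.crash p, r ≤ k

/-- A message that `p` sends to `q` in round `r` is not lost through a crash of `p`. -/
def Passes (c : CrashPattern n) (p q : Fin n) (r : ℕ) : Prop :=
  ∀ k ∈ c.crash p, r < k ∨ r = k ∧ c.passes p q = true

/-- `p` performs the local computation at the end of round `r`, if it is awake. -/
def Completes (c : CrashPattern n) (p : Fin n) (r : ℕ) : Prop :=
  ∀ k ∈ c.crash p, r < k ∨ r = k ∧ c.completes p = true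

/-- `p` never crashes. -/
def NonFaulty (c : CrashPattern n) (p : Fin n) : Prop :=
  c.crash p = none

/-- At most `f` players crash. -/
def AtMost (c : CrashPattern n) (f : ℕ) : Prop :=
  {p | ¬ c.NonFaulty p}.ncard ≤ f

instance (c : CrashPattern n) (p : Fin n) (r : ℕ) : Decidable (c.Alive p r) := by
  unfold Alive; infer_instance

instance (c : CrashPattern n) (p q : Fin n) (r : ℕ) : Decidable (c.Passes p q r) := by
  unfold Passes; infer_instance

instance (c : CrashPattern n) (p : Fin n) (r : ℕ) : Decidable (c.Completes p r) := by
  unfold Completes; infer_instance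

end CrashPattern

namespace Protocol

variable {n : ℕ}

/-- What `p` receives in round `r` from `q` if the players are in the states `s` at the start of the
round: the message that `q` sends to `p`, provided that `q` is alive and awake and that the message
is not lost through a crash of `q`. There is no channel from a player to itself. -/
def inbox (A : Protocol n) (c : CrashPattern n) (r : ℕ) (s : Fin n → A.State) (p q : Fin n) :
    Option Message :=
  if q ≠ p ∧ c.Passes q p r ∧ A.wake r (s q) = true then A.send r (s q) p else none

/-- The state of each player at the end of round `r` (for `r = 0`: before round `1`), in the
execution with inputs `x` and crash pattern `c`. A player that is asleep, or that has crashed, keeps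
its state, and in particular never receives the messages sent to it in that round. -/
def state (A : Protocol n) (x : Fin n → Bool) (c : CrashPattern n) : ℕ → Fin n → A.State
  | 0 => fun p => A.init p (x p)
  | r + 1 => fun p =>
    if c.Completes p (r + 1) ∧ A.wake (r + 1) (A.state x c r p) = true then
      A.step (r + 1) (A.state x c r p) (A.inbox c (r + 1) (A.state x c r) p)
    else A.state x c r p

/-- `p` is alive and awake in round `r`, where `1 ≤ r`. -/
def Awake (A : Protocol n) (x : Fin n → Bool) (c : CrashPattern n) (p : Fin n) (r : ℕ) : Prop :=
  1 ≤ r ∧ c.Alive p r ∧ A.wake r (A.state x c (r - 1) p) = true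

/-- `p` sends the message `m` to `q` in round `r`. This includes messages that get lost because the
sender crashes or because the recipient is asleep or has crashed. -/
def Sends (A : Protocol n) (x : Fin n → Bool) (c : CrashPattern n) (r : ℕ) (p q : Fin n)
    (m : Message) : Prop :=
  A.Awake x c p r ∧ A.send r (A.state x c (r - 1) p) q = some m

/-- `p` has decided on `v` by the end of round `r`. -/
def Decides (A : Protocol n) (x : Fin n → Bool) (c : CrashPattern n) (r : ℕ) (p : Fin n)
    (v : Bool) : Prop :=
  ∃ k ≤ r, A.output (A.state x c k p) = some v

/-- `A` solves binary consensus if at most `f` players crash. Decisions of faulty players count in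
agreement and validity. Agreement for `p = q` says that decisions are irrevocable. -/
structure SolvesConsensus (A : Protocol n) (f : ℕ) : Prop where
  termination : ∀ x c, c.AtMost f → ∀ p, c.NonFaulty p → ∃ r v, A.Decides x c r p v
  agreement : ∀ x c, c.AtMost f → ∀ p q r r' v w,
    A.Decides x c r p v → A.Decides x c r' q w → v = w
  validity : ∀ x c, c.AtMost f → ∀ p r v, A.Decides x c r p v → ∃ q, x q = v

/-- All players terminate within `R` rounds if at most `f` players crash: every player that does not
crash in the rounds `1, …, R` has decided by the end of round `R`, and it is never awake again. -/
def TerminatesWithin (A : Protocol n) (f R : ℕ) : Prop :=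
  ∀ x c, c.AtMost f → ∀ p, c.Alive p (R + 1) →
    (∃ v, A.Decides x c R p v) ∧ ∀ r, R < r → ¬ A.Awake x c p r

/-- The total number of messages sent, in the worst case with at most `f` crashes. -/
noncomputable def messageComplexity (A : Protocol n) (f : ℕ) : ℕ∞ :=
  ⨆ (x : Fin n → Bool) (c : CrashPattern n) (_ : c.AtMost f),
    {e : ℕ × Fin n × Fin n | ∃ m, A.Sends x c e.1 e.2.1 e.2.2 m}.encard

/-- The largest number of bits in a message, in the worst case with at most `f` crashes. -/
noncomputable def messageSize (A : Protocol n) (f : ℕ) : ℕ∞ :=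
  ⨆ (x : Fin n → Bool) (c : CrashPattern n) (_ : c.AtMost f)
    (r : ℕ) (p : Fin n) (q : Fin n) (m : Message) (_ : A.Sends x c r p q m), (m.length : ℕ∞)

/-- The maximum over all players of the number of rounds in which the player is awake, in the worst
case with at most `f` crashes. -/
noncomputable def energyComplexity (A : Protocol n) (f : ℕ) : ℕ∞ :=
  ⨆ (x : Fin n → Bool) (c : CrashPattern n) (_ : c.AtMost f) (p : Fin n),
    {r : ℕ | A.Awake x c p r}.encard

end Protocol

/-! Let `L = √n` and `k = n / (f + 1)`, and index round `r` by `t = r - 1`, so that `t` runs over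
`0, …, f`. Identifiers below `k * (f + 1)` form a grid with `k` rows and one column per round;
larger ones never speak. A committee is one row restricted to the columns of one block. Agreement is
a pigeonhole (`exists_clean_round`). A block with an entirely faulty committee has a faulty player
in each column; a block in which every round sees a crash of a member has one faulty player per
round. If each block were of one of these kinds, at least `f + 1` players would be faulty. So in
some block every committee has a non-faulty member and some round is clean. All its listeners adopt
the same value; the remaining committees of the block relay it, and the closing round gives it to
everybody (`exists_est_eq`). At most `L` players speak per round, to at most `L` listeners, or to
all `n` in about `f / L` closing rounds: `O(n ^ 2)` messages. A player is awake in closing rounds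
and around its turns, which come every `k` rounds of one block; `L / k` is also `O(f / L + 1)`. -/

namespace CommitteeConsensus

/-- Player `a` belongs to the committee that speaks in round `t + 1`. The rounds are divided into
blocks of length `√n`; the players of each block are divided into `n / (f + 1)` committees, each with
as many members as the block has rounds, and these take turns. -/
def Speaks (n f t a : ℕ) : Prop :=
  a % (f + 1) / n.sqrt = t / n.sqrt ∧ a / (f + 1) = t % (n / (f + 1))

/-- In round `t + 1`, which ends a block or the whole execution, everybody listens. -/
def Closing (n f t : ℕ) : Prop :=
  n.sqrt ∣ t + 1 ∨ t = f

/-- Player `a` listens in round `t + 1`. -/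
def Listens (n f t a : ℕ) : Prop :=
  Closing n f t ∨ Speaks n f (t + 1) a

instance (n f t a : ℕ) : Decidable (Speaks n f t a) := by
  unfold Speaks; infer_instance

instance (n f t : ℕ) : Decidable (Closing n f t) := by
  unfold Closing; infer_instance

instance (n f t a : ℕ) : Decidable (Listens n f t a) := by
  unfold Listens; infer_instance

/-- A player's identifier, its current estimate, and whether it has decided. -/
structure PlayerState (n : ℕ) where
  ident : Fin n
  est : Bool
  decided : Bool

/-- A player hears the bit `b`; a speaker also hears itself. -/
def Hears {n : ℕ} (f t : ℕ) (s : PlayerState n) (m : Fin n → Option Message) (b : Bool) : Prop :=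
  (Speaks n f t s.ident ∧ s.est = b) ∨ ∃ q, m q = some [b]

instance {n : ℕ} (f t : ℕ) (s : PlayerState n) (m : Fin n → Option Message) (b : Bool) :
    Decidable (Hears f t s m b) := by
  unfold Hears; infer_instance

/-- The minimum of the bits that are heard, and the old estimate if there are none. -/
def newEst {n : ℕ} (f t : ℕ) (s : PlayerState n) (m : Fin n → Option Message) : Bool :=
  if Hears f t s m false then false else if Hears f t s m true then true else s.est

/-- The state after a round `r` in which the messages `m` are received. -/
def nextState {n : ℕ} (f r : ℕ) (s : PlayerState n) (m : Fin n → Option Message) : PlayerState n :=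
  if Listens n f (r - 1) s.ident then ⟨s.ident, newEst f (r - 1) s m, decide (r = f + 1)⟩ else s

lemma ident_nextState {n f r : ℕ} {s : PlayerState n} {m : Fin n → Option Message} :
    (nextState f r s m).ident = s.ident := by
  unfold nextState
  split_ifs <;> rfl

lemma nextState_of_not_listens {n f r : ℕ} {s : PlayerState n} {m : Fin n → Option Message}
    (h : ¬ Listens n f (r - 1) s.ident) : nextState f r s m = s :=
  if_neg h

/-- The committee of each round passes its estimates on to the committee of the next round, and at the
end of each block to everybody. -/
def protocol (n f : ℕ) : Protocol n where
  State := PlayerState n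
  init p x := ⟨p, x, false⟩
  wake r s := decide (r ≤ f + 1 ∧ (Speaks n f (r - 1) s.ident ∨ Listens n f (r - 1) s.ident))
  send r s q := if Speaks n f (r - 1) s.ident ∧ Listens n f (r - 1) q then some [s.est] else none
  step := nextState f
  output s := if s.decided then some s.est else none

/-! ### One round of an execution: who listens and what is heard. -/

section Execution

variable {n f : ℕ} {x : Fin n → Bool} {c : CrashPattern n}

lemma newEst_eq_of_hears {t : ℕ} {s : PlayerState n} {m : Fin n → Option Message} {v : Bool}
    (h : Hears f t s m v) (h' : ∀ b, Hears f t s m b → b = v) : newEst f t s m = v := by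
  unfold newEst
  split_ifs with h0 h1
  · exact h' _ h0
  · exact h' _ h1
  · cases v <;> contradiction

lemma newEst_eq_of_est {t : ℕ} {s : PlayerState n} {m : Fin n → Option Message} {v : Bool}
    (h : s.est = v) (h' : ∀ b, Hears f t s m b → b = v) : newEst f t s m = v := by
  unfold newEst
  split_ifs with h0 h1
  · exact h' _ h0
  · exact h' _ h1
  · exact h

/-- Hearing something is essential: otherwise the old estimates, which may differ, are kept. -/
lemma newEst_congr {t : ℕ} {s s' : PlayerState n} {m m' : Fin n → Option Message}
    (h : ∀ b, Hears f t s m b ↔ Hears f t s' m' b) (h' : ∃ b, Hears f t s m b) :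
    newEst f t s m = newEst f t s' m' := by
  unfold newEst
  simp only [← h]
  split_ifs with h0 h1
  · rfl
  · rfl
  · obtain ⟨b, hb⟩ := h'
    cases b <;> contradiction

/-- The estimates in an execution. -/
abbrev est (f : ℕ) (x : Fin n → Bool) (c : CrashPattern n) (t : ℕ) (p : Fin n) : Bool :=
  PlayerState.est ((protocol n f).state x c t p)

lemma state_succ (t : ℕ) (p : Fin n) :
    (protocol n f).state x c (t + 1) p =
      if c.Completes p (t + 1) ∧
          (protocol n f).wake (t + 1) ((protocol n f).state x c t p) = true then
        (protocol n f).step (t + 1) ((protocol n f).state x c t p)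
          ((protocol n f).inbox c (t + 1) ((protocol n f).state x c t) p)
      else (protocol n f).state x c t p := rfl

lemma ident_state (t : ℕ) (p : Fin n) :
    PlayerState.ident ((protocol n f).state x c t p) = p := by
  induction t with
  | zero => rfl
  | succ t ih =>
    rw [state_succ]
    split_ifs
    · exact ident_nextState.trans ih
    · exact ih

lemma wake_iff {r t : ℕ} {p : Fin n} :
    (protocol n f).wake r ((protocol n f).state x c t p) = true ↔
      r ≤ f + 1 ∧ (Speaks n f (r - 1) p ∨ Listens n f (r - 1) p) := by
  have := ident_state (f := f) (x := x) (c := c) t p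
  change decide _ = true ↔ _
  rw [decide_eq_true_iff, this]

/-- What `p` hears in round `t + 1`, provided that it listens. -/
abbrev HearsIn (f : ℕ) (x : Fin n → Bool) (c : CrashPattern n) (t : ℕ) (p : Fin n) (b : Bool) :
    Prop :=
  Hears f t ((protocol n f).state x c t p)
    ((protocol n f).inbox c (t + 1) ((protocol n f).state x c t) p) b

lemma state_succ_of_listens {t : ℕ} {p : Fin n} (ht : t ≤ f) (hl : Listens n f t p)
    (hc : c.Completes p (t + 1)) :
    (protocol n f).state x c (t + 1) p =
      (⟨p, newEst f t ((protocol n f).state x c t p)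
        ((protocol n f).inbox c (t + 1) ((protocol n f).state x c t) p), decide (t = f)⟩ :
        PlayerState n) := by
  have hi := ident_state (f := f) (x := x) (c := c) t p
  rw [state_succ, if_pos ⟨hc, wake_iff.2 ⟨by omega, .inr hl⟩⟩]
  change nextState f (t + 1) _ _ = _
  simp [nextState, hi, hl]

lemma state_succ_of_not_listens {t : ℕ} {p : Fin n}
    (h : ¬ (t ≤ f ∧ Listens n f t p ∧ c.Completes p (t + 1))) :
    (protocol n f).state x c (t + 1) p = (protocol n f).state x c t p := by
  have hi := ident_state (f := f) (x := x) (c := c) t p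
  rw [state_succ]
  split_ifs with hw
  · have hw2 := wake_iff.1 hw.2
    refine nextState_of_not_listens ?_
    rw [hi]
    exact fun hl => h ⟨by omega, hl, hw.1⟩
  · rfl

lemma inbox_eq {t : ℕ} {p q : Fin n} {b : Bool} (ht : t ≤ f) (hl : Listens n f t p) :
    (protocol n f).inbox c (t + 1) ((protocol n f).state x c t) p q = some [b] ↔
      q ≠ p ∧ c.Passes q p (t + 1) ∧ Speaks n f t q ∧ est f x c t q = b := by
  have hi := ident_state (f := f) (x := x) (c := c) t q
  unfold Protocol.inbox
  simp only [wake_iff]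
  have hs : (protocol n f).send (t + 1) ((protocol n f).state x c t q) p =
      if Speaks n f t q then some [est f x c t q] else none := by
    change (if Speaks n f (t + 1 - 1) (PlayerState.ident _) ∧ _ then _ else _) = _
    rw [hi]
    simp [hl]
  rw [hs]
  by_cases h : Speaks n f t q <;> simp [h, ht, and_assoc]

/-- The case `q = p` stands for the missing channel from a player to itself, so all listeners are
treated alike. -/
lemma hearsIn_iff {t : ℕ} {p : Fin n} {b : Bool} (ht : t ≤ f) (hl : Listens n f t p)
    (hc : c.Completes p (t + 1)) :
    HearsIn f x c t p b ↔
      ∃ q, (q = p ∨ c.Passes q p (t + 1)) ∧ Speaks n f t q ∧ est f x c t q = b := by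
  have hi := ident_state (f := f) (x := x) (c := c) t p
  unfold HearsIn Hears
  simp only [inbox_eq ht hl, hi]
  constructor
  · rintro (h | ⟨q, -, h⟩)
    · exact ⟨p, .inl rfl, h⟩
    · exact ⟨q, .inr h.1, h.2⟩
  · rintro ⟨q, hq, h⟩
    by_cases hqp : q = p
    · subst hqp; exact .inl h
    · exact .inr ⟨q, hqp, hq.resolve_left hqp, h⟩

end Execution

/-! ### Crash predicates, and the pigeonhole for a clean round. -/

section Crashes

variable {n : ℕ} {c : CrashPattern n}

lemma alive_of_passes {p q : Fin n} {r : ℕ} (h : c.Passes p q r) : c.Alive p r :=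
  fun k hk => (h k hk).elim le_of_lt fun h => h.1.le

lemma alive_of_completes {p : Fin n} {r : ℕ} (h : c.Completes p r) : c.Alive p r :=
  fun k hk => (h k hk).elim le_of_lt fun h => h.1.le

lemma completes_of_alive_succ {p : Fin n} {r : ℕ} (h : c.Alive p (r + 1)) : c.Completes p r :=
  fun k hk => .inl (h k hk)

lemma passes_of_alive_of_ne {p q : Fin n} {r : ℕ} (h : c.Alive p r) (h' : c.crash p ≠ some r) :
    c.Passes p q r := by
  intro k hk
  refine .inl (lt_of_le_of_ne (h k hk) ?_)
  rintro rfl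
  exact h' hk

lemma NonFaulty.passes {p q : Fin n} {r : ℕ} (h : c.NonFaulty p) : c.Passes p q r := by
  intro k hk
  rw [show c.crash p = none from h] at hk
  cases hk

end Crashes

/-- In some block no committee is wiped out, and one of its rounds sees no crash of a member. -/
lemma exists_clean_round {n f : ℕ} (hf : f < n) {c : CrashPattern n} (hc : c.AtMost f) :
    ∃ t₀ ≤ f,
      (∀ t ≤ f, t / n.sqrt = t₀ / n.sqrt → ∃ p : Fin n, Speaks n f t p ∧ c.NonFaulty p) ∧
      ∀ p : Fin n, (p : ℕ) % (f + 1) / n.sqrt = t₀ / n.sqrt → c.crash p ≠ some (t₀ + 1) := by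
  by_contra! hcon
  let W : ℕ → Prop := fun j =>
    ∃ t ≤ f, t / n.sqrt = j ∧ ∀ p : Fin n, Speaks n f t p → ¬ c.NonFaulty p
  -- `W j`: block `j` has a wiped-out committee. Each round is charged to a faulty player of its own
  -- block, from which the round can be recovered: by the column if `W` holds, by the crash time
  -- otherwise.
  have key : ∀ t : Fin (f + 1), ∃ p : Fin n, ¬ c.NonFaulty p ∧
      (p : ℕ) % (f + 1) / n.sqrt = (t : ℕ) / n.sqrt ∧
      (W (t / n.sqrt) → (p : ℕ) % (f + 1) = t) ∧
      (¬ W (t / n.sqrt) → c.crash p = some ((t : ℕ) + 1)) := by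
    intro t
    by_cases hW : W (t / n.sqrt)
    · obtain ⟨t', ht', hj, hdead⟩ := id hW
      have hk : 0 < n / (f + 1) := Nat.div_pos hf (by omega)
      have hlt : t' % (n / (f + 1)) < n / (f + 1) := Nat.mod_lt _ hk
      -- The witness is the member in column `t` of the committee wiped out at `t'`.
      have hp : (t : ℕ) + (f + 1) * (t' % (n / (f + 1))) < n := by
        calc (t : ℕ) + (f + 1) * (t' % (n / (f + 1)))
            < (f + 1) + (f + 1) * (t' % (n / (f + 1))) := by have := t.2; omega
          _ = (f + 1) * (t' % (n / (f + 1)) + 1) := by ring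
          _ ≤ (f + 1) * (n / (f + 1)) := Nat.mul_le_mul_left _ hlt
          _ ≤ n := Nat.mul_div_le _ _
      have hmod : ((t : ℕ) + (f + 1) * (t' % (n / (f + 1)))) % (f + 1) = t := by
        rw [Nat.add_mul_mod_self_left, Nat.mod_eq_of_lt t.2]
      refine ⟨⟨_, hp⟩, hdead _ ⟨?_, ?_⟩, ?_, fun _ => hmod, fun h => absurd hW h⟩
      · simp only [hmod, hj]
      · simp only
        rw [Nat.add_mul_div_left _ _ (by omega), Nat.div_eq_of_lt t.2, zero_add]
      · simp only [hmod]
    · obtain ⟨p, hp, hcr⟩ := hcon t (by have := t.2; omega) (by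
        intro t' ht' hj
        by_contra! h
        exact hW ⟨t', ht', hj, h⟩)
      exact ⟨p, by simp [CrashPattern.NonFaulty, hcr], hp, fun h => absurd h hW, fun _ => hcr⟩
  choose g hg hblock hW hW' using key
  have hinj : Function.Injective g := by
    intro t t' h
    have hj : (t : ℕ) / n.sqrt = t' / n.sqrt := by rw [← hblock, ← hblock, h]
    apply Fin.ext
    by_cases hw : W (t / n.sqrt)
    · rw [← hW t hw, ← hW t' (hj ▸ hw), h]
    · have h1 := hW' t hw
      rw [h, hW' t' (hj ▸ hw)] at h1
      simpa using h1.symm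
  have hcard : f + 1 ≤ {p | ¬ c.NonFaulty p}.ncard := by
    have := Set.ncard_le_ncard (s := Set.range g) (t := {p | ¬ c.NonFaulty p})
      (by rintro _ ⟨t, rfl⟩; exact hg t) (Set.toFinite _)
    rwa [Set.ncard_range_of_injective hinj, Nat.card_eq_fintype_card, Fintype.card_fin] at this
  have : {p | ¬ c.NonFaulty p}.ncard ≤ f := hc
  omega

/-! ### Agreement from the clean round onwards, and validity. -/

section Agreement

variable {n f : ℕ} {x : Fin n → Bool} {c : CrashPattern n}

lemma est_succ_of_listens {t : ℕ} {p : Fin n} (ht : t ≤ f) (hl : Listens n f t p)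
    (hc : c.Completes p (t + 1)) :
    est f x c (t + 1) p = newEst f t ((protocol n f).state x c t p)
        ((protocol n f).inbox c (t + 1) ((protocol n f).state x c t) p) := by
  rw [est, state_succ_of_listens ht hl hc]

/-- If no speaker crashes, all listeners adopt the same estimate. -/
lemma exists_est_of_clean {t : ℕ} (ht : t ≤ f)
    (hne : ∃ p : Fin n, Speaks n f t p ∧ c.NonFaulty p)
    (hclean : ∀ p : Fin n, Speaks n f t p → c.crash p ≠ some (t + 1)) :
    ∃ v, ∀ p : Fin n, Listens n f t p → c.Completes p (t + 1) → est f x c (t + 1) p = v := by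
  have hh : ∀ (p : Fin n) b, Listens n f t p → c.Completes p (t + 1) → (HearsIn f x c t p b ↔
      ∃ q, c.Alive q (t + 1) ∧ Speaks n f t q ∧ est f x c t q = b) := by
    intro p b hl hc
    rw [hearsIn_iff ht hl hc]
    refine exists_congr fun q => and_congr_left fun hq => ⟨?_, fun h => .inr ?_⟩
    · rintro (rfl | h)
      exacts [alive_of_completes hc, alive_of_passes h]
    · exact passes_of_alive_of_ne h (hclean q hq.1)
  obtain ⟨u, hu, hun⟩ := hne
  by_cases hex : ∃ p₀ : Fin n, Listens n f t p₀ ∧ c.Completes p₀ (t + 1)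
  · obtain ⟨p₀, hl₀, hc₀⟩ := hex
    refine ⟨est f x c (t + 1) p₀, fun p hl hc => ?_⟩
    rw [est_succ_of_listens ht hl hc, est_succ_of_listens ht hl₀ hc₀]
    refine newEst_congr (fun b => (hh p b hl hc).trans (hh p₀ b hl₀ hc₀).symm) ?_
    exact ⟨_, (hh p _ hl hc).2 ⟨u, alive_of_passes (q := u) (NonFaulty.passes hun), hu, rfl⟩⟩
  -- Without listeners the claim is vacuous and `true` is arbitrary.
  · push Not at hex
    exact ⟨true, fun p hl hc => absurd hc (hex p hl)⟩

/-- Inside the block, players outside the committee may hold stale estimates; a non-faulty speaker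
guarantees that a listener hears `v` and overwrites its own. -/
lemma est_succ_of_speakers {t : ℕ} {v : Bool} (ht : t ≤ f)
    (hv : ∀ q : Fin n, Speaks n f t q → c.Alive q (t + 1) → est f x c t q = v)
    {p : Fin n} (hp : (∃ u : Fin n, Speaks n f t u ∧ c.NonFaulty u) ∨ est f x c t p = v)
    (hl : Listens n f t p) (hc : c.Completes p (t + 1)) : est f x c (t + 1) p = v := by
  have hall : ∀ b, HearsIn f x c t p b → b = v := by
    intro b hb
    obtain ⟨q, hq, hs, rfl⟩ := (hearsIn_iff ht hl hc).1 hb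
    refine hv q hs ?_
    rcases hq with rfl | hq
    exacts [alive_of_completes hc, alive_of_passes hq]
  rw [est_succ_of_listens ht hl hc]
  rcases hp with ⟨u, hu, hun⟩ | hp
  · refine newEst_eq_of_hears ((hearsIn_iff ht hl hc).2 ⟨u, .inr (NonFaulty.passes hun), hu, ?_⟩) hall
    exact hv u hu (alive_of_passes (q := u) (NonFaulty.passes hun))
  · exact newEst_eq_of_est hp hall

/-- Unanimity needs no live committee: a listener that hears nothing keeps `v`. This covers the
blocks after the clean one. -/
lemma est_succ_of_forall {t : ℕ} {v : Bool}
    (hv : ∀ q : Fin n, c.Alive q (t + 1) → est f x c t q = v)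
    {p : Fin n} (hc : c.Completes p (t + 1)) : est f x c (t + 1) p = v := by
  by_cases h : t ≤ f ∧ Listens n f t p ∧ c.Completes p (t + 1)
  · exact est_succ_of_speakers h.1 (fun q _ => hv q) (.inr (hv p (alive_of_completes hc))) h.2.1 hc
  · rw [est, state_succ_of_not_listens h]
    exact hv p (alive_of_completes hc)

/-- All players that reach the end of round `f + 1` have the same estimate. -/
lemma exists_est_eq (hf : f < n) (hc : c.AtMost f) :
    ∃ v, ∀ p : Fin n, c.Completes p (f + 1) → est f x c (f + 1) p = v := by
  obtain ⟨t₀, ht₀, hlive, hclean⟩ := exists_clean_round hf hc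
  obtain ⟨v, hv⟩ := exists_est_of_clean (x := x) ht₀ (hlive t₀ ht₀ rfl)
    fun p hp => hclean p hp.1
  refine ⟨v, ?_⟩
  -- In the clean block only listeners are known to hold `v`; after it, everybody is.
  have key : ∀ t, t₀ ≤ t → t ≤ f → ∀ p : Fin n, c.Completes p (t + 1) →
      (Listens n f t p ∨ t / n.sqrt ≠ t₀ / n.sqrt) → est f x c (t + 1) p = v := by
    intro t htt
    induction t, htt using Nat.le_induction with
    | base =>
      intro _ p hp h
      exact hv p (h.resolve_right (by simp)) hp
    | succ t htt ih =>
      intro htf p hp h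
      have ih := ih (by omega)
      by_cases hj : (t + 1) / n.sqrt = t₀ / n.sqrt
      · refine est_succ_of_speakers htf (fun q hq ha => ?_) (.inl (hlive _ htf hj))
          (h.resolve_right (by simpa using hj)) hp
        exact ih q (completes_of_alive_succ ha) (.inl (.inr hq))
      · refine est_succ_of_forall (fun q ha => ih q (completes_of_alive_succ ha) ?_) hp
        by_cases hj' : t / n.sqrt = t₀ / n.sqrt
        -- The block changes between `t` and `t + 1`, so `t` is closing and all players listen.
        · left; left; left
          by_contra hd
          rw [Nat.succ_div, if_neg hd] at hj
          exact hj hj'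
        · exact .inr hj'
  exact fun p hp => key f ht₀ le_rfl p hp (.inl (.inl (.inr rfl)))

lemma decided_iff (t : ℕ) (p : Fin n) :
    PlayerState.decided ((protocol n f).state x c t p) = true ↔
      f + 1 ≤ t ∧ c.Completes p (f + 1) := by
  induction t with
  | zero => simp [Protocol.state, protocol]
  | succ t ih =>
    by_cases h : t ≤ f ∧ Listens n f t p ∧ c.Completes p (t + 1)
    · rw [state_succ_of_listens h.1 h.2.1 h.2.2]
      simp only [decide_eq_true_eq]
      constructor
      · rintro rfl; exact ⟨le_rfl, h.2.2⟩
      · intro h'; omega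
    · rw [state_succ_of_not_listens h, ih]
      refine and_congr_left fun hc => ?_
      have : t ≠ f := by
        rintro rfl
        exact h ⟨le_rfl, .inl (.inr rfl), hc⟩
      omega

lemma state_eq_of_le {t : ℕ} (ht : f + 1 ≤ t) (p : Fin n) :
    (protocol n f).state x c t p = (protocol n f).state x c (f + 1) p := by
  induction t, ht using Nat.le_induction with
  | base => rfl
  | succ t ht ih => rw [state_succ_of_not_listens (by omega), ih]

lemma output_eq {t : ℕ} {p : Fin n} {v : Bool} :
    (protocol n f).output ((protocol n f).state x c t p) = some v ↔
      f + 1 ≤ t ∧ c.Completes p (f + 1) ∧ est f x c (f + 1) p = v := by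
  change (if PlayerState.decided _ = true then some (est f x c t p) else none) = some v ↔ _
  simp only [decided_iff]
  split_ifs with h
  · simp [h, est, state_eq_of_le h.1]
  · simp only [false_iff]
    tauto

lemma exists_input_eq_est (t : ℕ) (p : Fin n) : ∃ q, x q = est f x c t p := by
  induction t generalizing p with
  | zero => exact ⟨p, rfl⟩
  | succ t ih =>
    by_cases h : t ≤ f ∧ Listens n f t p ∧ c.Completes p (t + 1)
    · have hh : ∀ b, HearsIn f x c t p b → ∃ q, x q = b := by
        intro b hb
        obtain ⟨q, -, -, rfl⟩ := (hearsIn_iff h.1 h.2.1 h.2.2).1 hb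
        exact ih q
      rw [est_succ_of_listens h.1 h.2.1 h.2.2]
      unfold newEst
      split_ifs with h0 h1
      exacts [hh _ h0, hh _ h1, ih p]
    · simpa only [est, state_succ_of_not_listens h] using ih p

end Agreement

/-! ### Consensus and termination. -/

lemma solvesConsensus {n f : ℕ} (hf : f < n) : (protocol n f).SolvesConsensus f where
  termination x c _ p hp := by
    refine ⟨f + 1, _, f + 1, le_rfl, output_eq.2 ⟨le_rfl, ?_, rfl⟩⟩
    intro k hk
    rw [show c.crash p = none from hp] at hk
    cases hk
  agreement x c hc p q r r' v w := by
    rintro ⟨t, -, ht⟩ ⟨t', -, ht'⟩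
    obtain ⟨-, hp, rfl⟩ := output_eq.1 ht
    obtain ⟨-, hq, rfl⟩ := output_eq.1 ht'
    obtain ⟨u, hu⟩ := exists_est_eq (x := x) hf hc
    rw [hu p hp, hu q hq]
  validity x c _ p r v := by
    rintro ⟨t, -, ht⟩
    obtain ⟨-, -, rfl⟩ := output_eq.1 ht
    exact exists_input_eq_est _ _

lemma terminatesWithin {n f : ℕ} : (protocol n f).TerminatesWithin f (f + 1) := by
  intro x c _ p hp
  refine ⟨⟨_, f + 1, le_rfl, output_eq.2 ⟨le_rfl, completes_of_alive_succ hp, rfl⟩⟩, ?_⟩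
  rintro r hr ⟨-, -, hw⟩
  have := (wake_iff.1 hw).1
  omega

/-! ### Counting messages and awake rounds. -/

section Complexity

variable {n f : ℕ}

lemma card_closing_le : ((Finset.range (f + 1)).filter (Closing n f)).card ≤
    (f + 1) / n.sqrt + 1 := by
  unfold Closing
  rw [Finset.filter_or]
  refine (Finset.card_union_le _ _).trans (add_le_add (Nat.card_multiples _ _).le ?_)
  exact Finset.card_le_one.2 (by simp +contextual)

/-- The turns of `a` lie in one block and in one residue class modulo `k`, so `t / k` determines
them. -/
lemma card_speaks_rounds_le (hf : f < n) (a N : ℕ) :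
    ((Finset.range N).filter fun t => Speaks n f t a).card ≤ n.sqrt / (n / (f + 1)) + 2 := by
  set L := n.sqrt
  set k := n / (f + 1)
  have hk : 0 < k := Nat.div_pos hf (by omega)
  have hL : 0 < L := Nat.sqrt_pos.2 (by omega)
  set j := a % (f + 1) / L
  have := Finset.card_le_card_of_injOn (s := (Finset.range N).filter fun t => Speaks n f t a)
    (t := Finset.Icc (j * L / k) (j * L / k + (L / k + 1))) (fun t => t / k) ?_ ?_
  · rw [Nat.card_Icc] at this
    refine this.trans (le_of_eq ?_)
    rw [add_assoc, Nat.add_sub_cancel_left]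
  · intro t ht
    obtain ⟨-, hj, -⟩ := Finset.mem_filter.1 ht
    have hj : t / L = j := hj.symm
    have h1 : j * L ≤ t := hj ▸ Nat.div_mul_le_self t L
    have h2 : t ≤ j * L + L := hj ▸ (Nat.lt_div_mul_add hL).le
    simp only [Finset.coe_Icc, Set.mem_Icc]
    refine ⟨Nat.div_le_div_right h1, (Nat.div_le_div_right h2).trans ?_⟩
    rw [Nat.add_div hk]
    split_ifs <;> omega
  · intro t ht t' ht' h
    obtain ⟨-, -, hc⟩ := Finset.mem_filter.1 ht
    obtain ⟨-, -, hc'⟩ := Finset.mem_filter.1 ht'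
    rw [← Nat.div_add_mod t k, ← Nat.div_add_mod t' k, ← hc, ← hc']
    simp only at h
    rw [h]

lemma card_speakers_le (hn : 0 < n) (t : ℕ) :
    ((Finset.univ : Finset (Fin n)).filter fun p : Fin n => Speaks n f t p).card ≤ n.sqrt := by
  have hL : 0 < n.sqrt := Nat.sqrt_pos.2 hn
  have := Finset.card_le_card_of_injOn
    (s := (Finset.univ : Finset (Fin n)).filter fun p : Fin n => Speaks n f t p)
    (t := Finset.Ico (t / n.sqrt * n.sqrt) (t / n.sqrt * n.sqrt + n.sqrt))
    (fun p => (p : ℕ) % (f + 1)) ?_ ?_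
  · simpa using this
  · intro p hp
    obtain ⟨-, hj, -⟩ := Finset.mem_filter.1 hp
    simp only [Finset.coe_Ico, Set.mem_Ico]
    rw [← hj]
    exact ⟨Nat.div_mul_le_self _ _, Nat.lt_div_mul_add hL⟩
  · intro p hp q hq h
    obtain ⟨-, -, hc⟩ := Finset.mem_filter.1 hp
    obtain ⟨-, -, hc'⟩ := Finset.mem_filter.1 hq
    simp only at h
    apply Fin.ext
    rw [← Nat.div_add_mod p (f + 1), ← Nat.div_add_mod q (f + 1), hc, hc', h]

lemma card_listeners_le (hn : 0 < n) (t : ℕ) :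
    ((Finset.univ : Finset (Fin n)).filter fun p : Fin n => Listens n f t p).card ≤
      n.sqrt + if Closing n f t then n else 0 := by
  split_ifs with h
  · exact (Finset.card_filter_le _ _).trans (by simp)
  · simpa [Listens, h] using card_speakers_le hn (t + 1)

lemma card_messages_le (hf : f < n) :
    ∑ t ∈ Finset.range (f + 1),
      ((Finset.univ : Finset (Fin n)).filter fun p : Fin n => Speaks n f t p).card *
      ((Finset.univ : Finset (Fin n)).filter fun p : Fin n => Listens n f t p).card ≤ 3 * n ^ 2 := by
  have hn : 0 < n := by omega
  calc _ ≤ ∑ t ∈ Finset.range (f + 1),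
        (n.sqrt * n.sqrt + n.sqrt * if Closing n f t then n else 0) := by
        refine Finset.sum_le_sum fun t _ => ?_
        rw [← mul_add]
        exact Nat.mul_le_mul (card_speakers_le hn t) (card_listeners_le hn t)
    _ = (f + 1) * (n.sqrt * n.sqrt) +
        n.sqrt * (((Finset.range (f + 1)).filter (Closing n f)).card * n) := by
        rw [Finset.sum_add_distrib]
        congr 1
        · simp
        · rw [← Finset.mul_sum, ← Finset.sum_filter, Finset.sum_const, smul_eq_mul]
    _ ≤ n * n + (n.sqrt * ((f + 1) / n.sqrt + 1)) * n := by
        rw [mul_assoc]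
        gcongr
        · omega
        · exact Nat.sqrt_le n
        · exact card_closing_le
    _ ≤ n * n + (n + n) * n := by
        gcongr
        rw [mul_add, mul_one]
        exact add_le_add ((Nat.mul_div_le _ _).trans (by omega)) (Nat.sqrt_le_self n)
    _ = 3 * n ^ 2 := by ring

lemma messageComplexity_le (hf : f < n) :
    (protocol n f).messageComplexity f ≤ ((3 * n ^ 2 : ℕ) : ℕ∞) := by
  refine iSup_le fun x => iSup_le fun c => iSup_le fun _ => ?_
  let S : Finset (ℕ × Fin n × Fin n) := (Finset.range (f + 1)).biUnion fun t =>
    {t + 1} ×ˢ (((Finset.univ : Finset (Fin n)).filter fun p : Fin n => Speaks n f t p) ×ˢ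
      ((Finset.univ : Finset (Fin n)).filter fun p : Fin n => Listens n f t p))
  have hS : S.card ≤ 3 * n ^ 2 := by
    refine Finset.card_biUnion_le.trans (le_trans (le_of_eq ?_) (card_messages_le hf))
    simp [Finset.card_product]
  refine (Set.encard_le_encard (t := (S : Set _)) ?_).trans ?_
  · rintro ⟨r, p, q⟩ ⟨m, ⟨hr, -, hw⟩, hm⟩
    have hw := (wake_iff.1 hw).1
    have hi := ident_state (f := f) (x := x) (c := c) (r - 1) p
    change (if Speaks n f (r - 1) (PlayerState.ident _) ∧ Listens n f (r - 1) q then _ else none)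
      = some m at hm
    rw [hi] at hm
    have h : Speaks n f (r - 1) p ∧ Listens n f (r - 1) q := by
      by_contra h
      simp [h] at hm
    simp only [S, Finset.mem_coe, Finset.mem_biUnion, Finset.mem_product, Finset.mem_singleton,
      Finset.mem_filter, Finset.mem_univ, true_and, Finset.mem_range]
    simp only at hr hw
    exact ⟨r - 1, by omega, by omega, h⟩
  · rw [Set.encard_coe_eq_coe_finsetCard]
    exact_mod_cast hS

lemma messageSize_le : (protocol n f).messageSize f ≤ 1 := by
  refine iSup_le fun x => iSup_le fun c => iSup_le fun _ => iSup_le fun r => iSup_le fun p =>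
    iSup_le fun q => iSup_le fun m => iSup_le fun hm => ?_
  have hm : (if _ ∧ _ then some [est f x c (r - 1) p] else none) = some m := hm.2
  split_ifs at hm
  cases hm
  simp

lemma energyComplexity_le (hf : f < n) :
    (protocol n f).energyComplexity f ≤
      (((f + 1) / n.sqrt + 2 * (n.sqrt / (n / (f + 1))) + 5 : ℕ) : ℕ∞) := by
  refine iSup_le fun x => iSup_le fun c => iSup_le fun _ => iSup_le fun p => ?_
  -- The turn `t` costs round `t + 1` for speaking and round `t` for listening beforehand. The range
  -- includes `t = f + 1`, which is listened for in the last round but never spoken.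
  let S := (Finset.range (f + 2)).filter fun t => Speaks n f t p
  let B := (Finset.range (f + 1)).filter (Closing n f)
  have hS : S.card ≤ _ := card_speaks_rounds_le hf p (f + 2)
  have hB : B.card ≤ _ := card_closing_le
  refine (Set.encard_le_encard
    (t := ((S.image Nat.succ ∪ (S ∪ B.image Nat.succ) : Finset ℕ) : Set ℕ)) ?_).trans ?_
  · rintro r ⟨hr, -, hw⟩
    obtain ⟨t, rfl⟩ := Nat.exists_eq_add_of_le' hr
    obtain ⟨hle, h⟩ := wake_iff.1 hw
    simp only [S, B, Finset.mem_coe, Finset.mem_union, Finset.mem_image, Finset.mem_filter,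
      Finset.mem_range]
    rcases h with h | h | h
    · exact .inl ⟨t, ⟨by omega, h⟩, rfl⟩
    · exact .inr (.inr ⟨t, ⟨by omega, h⟩, rfl⟩)
    · exact .inr (.inl ⟨by omega, h⟩)
  · rw [Set.encard_coe_eq_coe_finsetCard, Nat.cast_le]
    have h1 := Finset.card_union_le (S.image Nat.succ) (S ∪ B.image Nat.succ)
    have h2 := Finset.card_union_le S (B.image Nat.succ)
    have h3 : (S.image Nat.succ).card ≤ S.card := Finset.card_image_le
    have h4 : (B.image Nat.succ).card ≤ B.card := Finset.card_image_le
    omega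

lemma energy_bound (hf : f < n) {M : ℕ} (hM : 1 ≤ M) (h : (f : ℝ) / Real.sqrt n ≤ M) :
    (f + 1) / n.sqrt + 2 * (n.sqrt / (n / (f + 1))) + 5 ≤ 15 * M := by
  have hn : 0 < n := by omega
  have hL : 0 < n.sqrt := Nat.sqrt_pos.2 hn
  have hk : 0 < n / (f + 1) := Nat.div_pos hf (by omega)
  have hfL : f + 1 ≤ 2 * M * n.sqrt := by
    have hs : 0 < Real.sqrt n := Real.sqrt_pos.2 (by exact_mod_cast hn)
    have h1 : Real.sqrt n < n.sqrt + 1 := by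
      rw [Real.sqrt_lt' (by positivity)]
      have := Nat.lt_succ_sqrt' n
      exact_mod_cast this
    have h2 : (f : ℝ) < M * (n.sqrt + 1) := by
      rw [div_le_iff₀ hs] at h
      have : (0 : ℝ) < M := by exact_mod_cast hM
      nlinarith
    have h3 : f < M * (n.sqrt + 1) := by exact_mod_cast h2
    nlinarith
  have h1 : (f + 1) / n.sqrt ≤ 2 * M :=
    Nat.div_le_of_le_mul (by rw [mul_comm]; exact hfL)
  -- Since `L ^ 2 ≤ n < 2 * (f + 1) * k`, the quotient `L / k` is at most `2 * (f + 1) / L`.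
  have h2 : n.sqrt / (n / (f + 1)) ≤ 4 * M := by
    refine Nat.div_le_of_le_mul ?_
    have h3 : n < (f + 1) * (n / (f + 1)) + (f + 1) := Nat.lt_mul_div_succ n (by omega)
    have h4 : n.sqrt * n.sqrt ≤ n := Nat.sqrt_le n
    have h5 : (f + 1) ≤ (f + 1) * (n / (f + 1)) := Nat.le_mul_of_pos_right _ hk
    have h6 : (f + 1) * (n / (f + 1)) ≤ 2 * M * n.sqrt * (n / (f + 1)) :=
      Nat.mul_le_mul_right _ hfL
    refine Nat.le_of_mul_le_mul_right ?_ hL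
    calc n.sqrt * n.sqrt ≤ 2 * (2 * M * n.sqrt * (n / (f + 1))) := by omega
      _ = n / (f + 1) * (4 * M) * n.sqrt := by ring
  omega

end Complexity

end CommitteeConsensus

theorem theorem2 :
    ∃ (A : (n f : ℕ) → Protocol n) (C : ℕ), ∀ n f : ℕ, f < n →
      (A n f).SolvesConsensus f ∧
      (A n f).TerminatesWithin f (f + 1) ∧
      (A n f).messageComplexity f ≤ ((C * n ^ 2 : ℕ) : ℕ∞) ∧
      (A n f).messageSize f ≤ (C : ℕ∞) ∧
      (A n f).energyComplexity f ≤ ((C * max 1 ⌈(f : ℝ) / Real.sqrt n⌉₊ : ℕ) : ℕ∞) := by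
  -- The energy bound dictates `15 = 2 + 2 * 4 + 5`; messages need only `3` and their size only `1`.
  refine ⟨CommitteeConsensus.protocol, 15, fun n f hf => ⟨CommitteeConsensus.solvesConsensus hf,
    CommitteeConsensus.terminatesWithin, ?_, ?_, ?_⟩⟩
  · refine (CommitteeConsensus.messageComplexity_le hf).trans (Nat.cast_le.2 ?_)
    exact Nat.mul_le_mul_right _ (by norm_num)
  · exact CommitteeConsensus.messageSize_le.trans (by norm_num)
  · refine (CommitteeConsensus.energyComplexity_le hf).trans (Nat.cast_le.2 ?_)
    refine CommitteeConsensus.energy_bound hf (le_max_left _ _) ((Nat.le_ceil _).trans ?_)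
    exact_mod_cast le_max_right _ _
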